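/- Let $b$ be an analytic function on the open unit disc $\mathbb D$ with values in the complex $n\times n$ matrices such that $\|b(z)\|<1$ (operator norm) for all $z\in\mathbb D$, and let $\alpha$ be a unitary $n\times n$ matrix. Put $H_\alpha(z)=(I+b(z)\alpha^*)(I-b(z)\alpha^*)^{-1}$, and let $\boldsymbol\mu^\alpha$ be the associated Aleksandrov–Clark measure, i.e. the finite non-negative matrix-valued Borel measure on the unit circle $\mathbb T$ with $$H_\alpha(z)=i\,\operatorname{Im}H_\alpha(0)+\int_{\mathbb T}\frac{\zeta+z}{\zeta-z}\,\boldsymbol\mu^\alpha(d\zeta)\qquad(z\in\mathbb D),$$ where $\operatorname{Im}A=(A-A^*)/(2i)$. Let $m$ be normalized Lebesgue measure on $\mathbb T$. Let $\mu^\alpha=\operatorname{tr}\boldsymbol\mu^\alpha$, let $W^\alpha$ be the matrix-valued density with $d\boldsymbol\mu^\alpha=W^\alpha\,d\mu^\alpha$, let $w^\alpha$ be the density of the absolutely continuous part of $\mu^\alpha$ with respect to $m$, and let $\widetilde W^\alpha=w^\alpha W^\alpha$ be the Lebesgue density of $\boldsymbol\mu^\alpha$. For $\lambda\in\mathbb T$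 let $b(\lambda)$ denote the non-tangential limit of $b$ at $\lambda$, and let $\Delta_\alpha(\lambda)=(I-\alpha b(\lambda)^*b(\lambda)\alpha^*)^{1/2}$ (positive semidefinite square root). Then for $m$-almost every $\lambda\in\mathbb T$ the non-tangential limit $b(\lambda)$ exists, $I-b(\lambda)\alpha^*$ is invertible, $$\widetilde W^\alpha(\lambda)=(I-\alpha b(\lambda)^*)^{-1}\,\Delta_\alpha(\lambda)^2\,(I-b(\lambda)\alpha^*)^{-1},$$ and consequently $\operatorname{rank}\widetilde W^\alpha(\lambda)=\operatorname{rank}\Delta_\alpha(\lambda)$. -/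

import Mathlib

open MeasureTheory Filter Topology
open scoped MatrixOrder ComplexOrder

namespace AleksandrovClark

noncomputable section

/-- The unit circle carries its Borel σ-algebra. -/
instance instMeasurableSpaceCircle : MeasurableSpace Circle := borel Circle

instance instBorelSpaceCircle : BorelSpace Circle := ⟨rfl⟩

/-- Normalized Lebesgue (arc length) measure on the unit circle: the image of the
probability Haar measure of `ℝ / ℤ` under `x ↦ exp (2 π i x)`. -/
def circleMeasure : Measure Circle :=
  (AddCircle.haarAddCircle (T := (1 : ℝ))).map AddCircle.toCircle

/-- The Stolz region of aperture `t` at the point `ζ` of the unit circle. -/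
def stolz (t : ℝ) (ζ : Circle) : Set ℂ :=
  {z : ℂ | ‖z‖ < 1 ∧ ‖z - (ζ : ℂ)‖ < t * (1 - ‖z‖)}

/-- The filter of non-tangential approach to `ζ`: a function converges along it if and only if,
for every `t > 1`, it converges to that limit as `z → ζ` within the Stolz region
of aperture `t`. -/
def nontangential (ζ : Circle) : Filter ℂ :=
  ⨆ t : ℝ, ⨆ _ : 1 < t, 𝓝[stolz t ζ] (ζ : ℂ)

variable {n : ℕ}

open scoped Matrix.Norms.L2Operator in
/-- The matrix-valued Schur class: analytic `n × n` matrix functions on the open unit disc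
whose operator norm (largest singular value) is strictly less than one at every point.
Values outside the disc are irrelevant. -/
structure IsSchur (b : ℂ → Matrix (Fin n) (Fin n) ℂ) : Prop where
  analytic : DifferentiableOn ℂ b (Metric.ball 0 1)
  norm_lt_one : ∀ z ∈ Metric.ball (0 : ℂ) 1, ‖b z‖ < 1

/-- The non-tangential boundary value `b(ζ)` (meaningful where the limit exists). -/
def boundaryValue (b : ℂ → Matrix (Fin n) (Fin n) ℂ) (ζ : Circle) : Matrix (Fin n) (Fin n) ℂ :=
  limUnder (nontangential ζ) b

open scoped Matrix

/-- The defect `(I - α B* B α*)^{1/2}` of a contraction `B`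
(the positive semidefinite square root). -/
def defect (α B : Matrix (Fin n) (Fin n) ℂ) : Matrix (Fin n) (Fin n) ℂ :=
  CFC.sqrt (1 - α * Bᴴ * B * αᴴ)

/-- The function `H_α(z) = (I + b(z) α*) (I - b(z) α*)⁻¹`. -/
def herglotz (b : ℂ → Matrix (Fin n) (Fin n) ℂ) (α : Matrix (Fin n) (Fin n) ℂ) (z : ℂ) :
    Matrix (Fin n) (Fin n) ℂ :=
  (1 + b z * αᴴ) * (1 - b z * αᴴ)⁻¹

/-- The imaginary part `(A - A*) / (2i)` of a matrix. -/
def imPart (A : Matrix (Fin n) (Fin n) ℂ) : Matrix (Fin n) (Fin n) ℂ :=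
  (2 * Complex.I)⁻¹ • (A - Aᴴ)

/-- A finite non-negative `n × n`-matrix-valued Borel measure on the unit circle: a countably
additive matrix-valued set function with positive semidefinite values. -/
structure PosMatrixMeasure (n : ℕ) where
  toVectorMeasure : VectorMeasure Circle (Matrix (Fin n) (Fin n) ℂ)
  posSemidef : ∀ E : Set Circle, (toVectorMeasure E).PosSemidef

namespace PosMatrixMeasure

variable (μ : PosMatrixMeasure n)

/-- The `(i, j)` entry of a matrix-valued measure, a complex measure. -/
def entry (i j : Fin n) : ComplexMeasure Circle :=
  μ.toVectorMeasure.mapRange (Matrix.entryAddMonoidHom ℂ i j)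
    (continuous_id.matrix_elem i j)

/-- The trace `∑ₖ μₖₖ` as a signed measure (its values are real because the diagonal entries of a
positive semidefinite matrix are real). -/
def traceSigned : SignedMeasure Circle :=
  ∑ k : Fin n, ComplexMeasure.re (μ.entry k k)

theorem traceSigned_apply (E : Set Circle) :
    μ.traceSigned E = (μ.toVectorMeasure E).trace.re := by
  have h : ∀ s : Finset (Fin n), (∑ k ∈ s, ComplexMeasure.re (μ.entry k k)) E
      = ∑ k ∈ s, (μ.toVectorMeasure E k k).re := by
    intro s
    induction s using Finset.induction_on with
    | empty => simp
    | insert a s ha ih =>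
      rw [Finset.sum_insert ha, Finset.sum_insert ha, add_apply, ih]
      rfl
  rw [traceSigned, h, Matrix.trace, Complex.re_sum]
  rfl

theorem traceSigned_nonneg :
    VectorMeasure.restrict (0 : SignedMeasure Circle) Set.univ ≤
      VectorMeasure.restrict μ.traceSigned Set.univ := by
  rw [VectorMeasure.restrict_univ, VectorMeasure.restrict_univ]
  intro E _
  rw [traceSigned_apply]
  exact (Complex.le_def.1 (μ.posSemidef E).trace_nonneg).1

/-- The trace of a non-negative matrix-valued measure, a finite positive measure. -/
def traceMeasure : Measure Circle :=
  μ.traceSigned.toMeasureOfZeroLE Set.univ MeasurableSet.univ μ.traceSigned_nonneg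

/-- The density `W` of a matrix-valued measure with respect to its trace, taken entrywise. -/
def traceDensity (ζ : Circle) : Matrix (Fin n) (Fin n) ℂ :=
  Matrix.of fun i j => (μ.entry i j).rnDeriv μ.traceMeasure ζ

/-- The Lebesgue density `w W`, where `w` is the density of the absolutely continuous part
of the trace measure with respect to normalized Lebesgue measure. -/
def lebesgueDensity (ζ : Circle) : Matrix (Fin n) (Fin n) ℂ :=
  (μ.traceMeasure.rnDeriv circleMeasure ζ).toReal • μ.traceDensity ζ

/-- The entrywise integral `∫ f dμ` of a scalar function. -/
def integral (f : Circle → ℂ) : Matrix (Fin n) (Fin n) ℂ :=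
  Matrix.of fun i j => VectorMeasure.integral (μ.entry i j) f (ContinuousLinearMap.mul ℝ ℂ)

end PosMatrixMeasure

/-- `μ` is the Aleksandrov–Clark measure of `b` with parameter `α`: the finite non-negative
matrix-valued measure on the circle that represents `H_α` by the Herglotz formula. -/
def IsClarkMeasure (b : ℂ → Matrix (Fin n) (Fin n) ℂ) (α : Matrix (Fin n) (Fin n) ℂ)
    (μ : PosMatrixMeasure n) : Prop :=
  ∀ z ∈ Metric.ball (0 : ℂ) 1,
    herglotz b α z = Complex.I • imPart (herglotz b α 0)
      + μ.integral fun ζ : Circle => ((ζ : ℂ) + z) / ((ζ : ℂ) - z)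

end

end AleksandrovClark

namespace AleksandrovClark

open Metric

/-! ### Normalized arc length measure -/

/-! The non-tangential limit of `H_α + H_α*` is computed in two ways and the answers are compared.
Algebraically, the Cayley transform (`cayley_add_conjTranspose`) gives `H_α + H_α* = 2 (1 - α b*)⁻¹
(1 - α b* b α*) (1 - b α*)⁻¹` inside the disc. Analytically, the term `i Im H_α(0)` is
skew-Hermitian and cancels, so the Herglotz formula makes `H_α + H_α*` twice the Poisson integral of
the Clark measure (`herglotz_add_conjTranspose_apply`).

Fatou's theorem for measures (`ae_tendsto_integral_poisson`) sends the Poisson integral to the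
Lebesgue density almost everywhere: dyadic balls control the kernel in a Stolz region, the singular
part differentiates to zero, and the absolutely continuous part is handled at Lebesgue points. On
the algebraic side, the entries of `b` are bounded and holomorphic, hence Poisson integrals of
integrable functions, so `b` has boundary values.

Invertibility of `1 - b α*` on the boundary comes from its determinant, a bounded zero-free
function. The mean value property of `log |f|` and Fatou's lemma prevent such a function from having
limit zero on a set of positive measure (`ae_limit_ne_zero`). The rank equality follows since the
outer factors are invertible and a Hermitian matrix has the rank of its square. -/

theorem measurableEmbedding_toCircle :
    MeasurableEmbedding (AddCircle.toCircle : AddCircle (1 : ℝ) → Circle) := by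
  have h := (AddCircle.homeomorphCircle (T := (1 : ℝ)) one_ne_zero).measurableEmbedding
  have he : ⇑(AddCircle.homeomorphCircle (T := (1 : ℝ)) one_ne_zero) = AddCircle.toCircle := by
    ext x
    rw [AddCircle.homeomorphCircle_apply]
  rwa [he] at h

theorem haarAddCircle_one :
    (AddCircle.haarAddCircle : Measure (AddCircle (1 : ℝ))) = volume := by
  rw [AddCircle.volume_eq_smul_haarAddCircle]
  simp

instance isProbabilityMeasure_circleMeasure : IsProbabilityMeasure circleMeasure :=
  Measure.isProbabilityMeasure_map measurableEmbedding_toCircle.measurable.aemeasurable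

theorem integral_circleMeasure {E : Type*} [NormedAddCommGroup E] [NormedSpace ℝ E]
    (F : ℂ → E) : ∫ ζ : Circle, F ζ ∂circleMeasure = Real.circleAverage F 0 1 := by
  rw [circleMeasure, measurableEmbedding_toCircle.integral_map, haarAddCircle_one,
    ← AddCircle.intervalIntegral_preimage 1 0, zero_add, Real.circleAverage_def]
  have h : ∀ x : ℝ, F (AddCircle.toCircle (x : AddCircle (1 : ℝ)))
      = (fun θ : ℝ => F (circleMap 0 1 θ)) ((2 * Real.pi) * x) := by
    intro x
    rw [AddCircle.toCircle_apply_mk, Circle.coe_exp]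
    simp [circleMap]
  simp_rw [h]
  rw [intervalIntegral.integral_comp_mul_left (fun θ : ℝ => F (circleMap 0 1 θ)) (by positivity)]
  simp

theorem dist_toCircle_coe (x y : ℝ) :
    dist (AddCircle.toCircle (x : AddCircle (1 : ℝ))) (AddCircle.toCircle (y : AddCircle (1 : ℝ)))
      = 2 * |Real.sin (Real.pi * (x - y))| := by
  change dist ((AddCircle.toCircle (x : AddCircle (1 : ℝ)) : Circle) : ℂ)
    (AddCircle.toCircle (y : AddCircle (1 : ℝ)) : Circle) = _
  rw [dist_eq_norm, AddCircle.toCircle_apply_mk, AddCircle.toCircle_apply_mk,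
    Circle.coe_exp, Circle.coe_exp]
  -- Factoring out the midpoint of the arc leaves `2i` times the sine of half the angle.
  have h : Complex.exp (↑(2 * Real.pi / 1 * x) * Complex.I)
      - Complex.exp (↑(2 * Real.pi / 1 * y) * Complex.I)
      = Complex.exp (↑(Real.pi * (x + y)) * Complex.I)
        * (2 * Complex.I * Complex.sin (↑(Real.pi * (x - y)))) := by
    rw [Complex.sin, show (↑(2 * Real.pi / 1 * x) : ℂ) * Complex.I
        = ↑(Real.pi * (x + y)) * Complex.I + ↑(Real.pi * (x - y)) * Complex.I by push_cast; ring,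
      show (↑(2 * Real.pi / 1 * y) : ℂ) * Complex.I
        = ↑(Real.pi * (x + y)) * Complex.I + -↑(Real.pi * (x - y)) * Complex.I by push_cast; ring,
      Complex.exp_add, Complex.exp_add]
    linear_combination (- Complex.exp (↑(Real.pi * (x + y)) * Complex.I) *
      (Complex.exp (-↑(Real.pi * (x - y)) * Complex.I)
        - Complex.exp (↑(Real.pi * (x - y)) * Complex.I))) * Complex.I_sq
  rw [h, norm_mul, Complex.norm_exp_ofReal_mul_I, ← Complex.ofReal_sin, norm_mul,
    Complex.norm_real, Real.norm_eq_abs]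
  simp

theorem exists_coe_eq_norm (x : AddCircle (1 : ℝ)) :
    ∃ r : ℝ, (r : AddCircle (1 : ℝ)) = x ∧ |r| = ‖x‖ ∧ |r| ≤ 1 / 2 := by
  induction x using QuotientAddGroup.induction_on with
  | H t =>
    refine ⟨t - round t, ?_, ?_, ?_⟩
    · have h : ((round t : ℝ) : AddCircle (1 : ℝ)) = 0 := by
        rw [AddCircle.coe_eq_zero_iff]
        exact ⟨round t, by simp⟩
      rw [AddCircle.coe_sub, h, sub_zero]
    · exact (UnitAddCircle.norm_eq (x := t)).symm
    · exact abs_sub_round t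

/-- With the representative `|r| ≤ 1/2` of the difference, the chord is `2 |sin (π r)|`, and
Jordan's inequality `2 |r| ≤ |sin (π r)| ≤ π |r|` applies. Ball volumes on `ℝ / ℤ` thereby transfer
to the circle. -/
theorem dist_toCircle_bounds (x y : AddCircle (1 : ℝ)) :
    4 * dist x y ≤ dist x.toCircle y.toCircle ∧
      dist x.toCircle y.toCircle ≤ 2 * Real.pi * dist x y := by
  obtain ⟨r, hr, hn, hle⟩ := exists_coe_eq_norm (x - y)
  induction y using QuotientAddGroup.induction_on with
  | H t =>
    have hx : x = ((r + t : ℝ) : AddCircle (1 : ℝ)) := by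
      rw [AddCircle.coe_add, hr]; simp
    rw [dist_eq_norm x, ← hn, hx]
    have hd := dist_toCircle_coe (r + t) t
    rw [add_sub_cancel_right] at hd
    have hd' : dist (AddCircle.toCircle ((r + t : ℝ) : AddCircle (1 : ℝ)))
      (AddCircle.toCircle (QuotientAddGroup.mk t)) = 2 * |Real.sin (Real.pi * r)| := hd
    rw [hd']
    have hpi := Real.pi_pos
    constructor
    · have := Real.mul_abs_le_abs_sin (x := Real.pi * r) (by
        rw [abs_mul, abs_of_pos hpi]; nlinarith)
      rw [abs_mul, abs_of_pos hpi] at this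
      have h2 : 2 / Real.pi * (Real.pi * |r|) = 2 * |r| := by field_simp
      linarith
    · have := Real.abs_sin_le_abs (x := Real.pi * r)
      rw [abs_mul, abs_of_pos hpi] at this
      linarith

theorem circleMeasure_apply (s : Set Circle) :
    circleMeasure s = volume (AddCircle.toCircle ⁻¹' s : Set (AddCircle (1 : ℝ))) := by
  rw [circleMeasure, measurableEmbedding_toCircle.map_apply, haarAddCircle_one]

theorem toCircle_surjective :
    Function.Surjective (AddCircle.toCircle : AddCircle (1 : ℝ) → Circle) := by
  intro ζ
  refine ⟨(AddCircle.homeomorphCircle (T := (1 : ℝ)) one_ne_zero).symm ζ, ?_⟩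
  rw [← AddCircle.homeomorphCircle_apply one_ne_zero, Homeomorph.apply_symm_apply]

theorem circleMeasure_closedBall_le (ζ : Circle) (δ : ℝ) :
    circleMeasure (closedBall ζ δ) ≤ ENNReal.ofReal δ := by
  obtain ⟨x, rfl⟩ := toCircle_surjective ζ
  rw [circleMeasure_apply]
  have h : (AddCircle.toCircle ⁻¹' closedBall x.toCircle δ : Set (AddCircle (1 : ℝ)))
      ⊆ closedBall x (δ / 4) := by
    intro y hy
    have h1 := (dist_toCircle_bounds y x).1
    have h2 : dist y.toCircle x.toCircle ≤ δ := hy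
    rw [mem_closedBall]
    linarith
  refine (measure_mono h).trans ?_
  rw [AddCircle.volume_closedBall]
  rcases le_total 0 δ with hδ | hδ
  · exact ENNReal.ofReal_le_ofReal ((min_le_right _ _).trans (by linarith))
  · rw [ENNReal.ofReal_of_nonpos ((min_le_right _ _).trans (by linarith))]
    exact zero_le

/-- The restriction `δ ≤ 3 < π` keeps the inscribed arc, of length `δ / π`, from exceeding the total
length `1`. -/
theorem le_circleMeasure_closedBall (ζ : Circle) {δ : ℝ} (hδ : δ ≤ 3) :
    ENNReal.ofReal (δ / Real.pi) ≤ circleMeasure (closedBall ζ δ) := by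
  obtain ⟨x, rfl⟩ := toCircle_surjective ζ
  rw [circleMeasure_apply]
  have hpi := Real.pi_gt_three
  have h : closedBall x (δ / (2 * Real.pi)) ⊆
      (AddCircle.toCircle ⁻¹' closedBall x.toCircle δ : Set (AddCircle (1 : ℝ))) := by
    intro y hy
    have h1 := (dist_toCircle_bounds y x).2
    have h2 : dist y x ≤ δ / (2 * Real.pi) := hy
    rw [le_div_iff₀ (by positivity)] at h2
    rw [Set.mem_preimage, mem_closedBall]
    linarith
  refine le_trans ?_ (measure_mono h)
  rw [AddCircle.volume_closedBall]
  refine ENNReal.ofReal_le_ofReal (le_min ?_ (le_of_eq (by field_simp)))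
  rw [div_le_one (by linarith)]
  linarith

/-- The constant `8` works because `2 ε ≤ 8 ε / π` when `π ≤ 4`. Doubling supplies the Vitali family
behind the differentiation theorems. -/
instance isUnifLocDoublingMeasure_circleMeasure : IsUnifLocDoublingMeasure circleMeasure := by
  refine ⟨⟨8, ?_⟩⟩
  have : Set.Ioc (0 : ℝ) 3 ∈ 𝓝[>] (0 : ℝ) := Ioc_mem_nhdsGT (by norm_num)
  filter_upwards [this] with ε hε ζ
  refine (circleMeasure_closedBall_le ζ _).trans ?_
  grw [← le_circleMeasure_closedBall ζ hε.2]
  rw [show ((8 : NNReal) : ENNReal) = ENNReal.ofReal 8 by norm_num,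
    ← ENNReal.ofReal_mul (by norm_num)]
  refine ENNReal.ofReal_le_ofReal ?_
  have hpi := Real.pi_le_four
  have hpi' := Real.pi_pos
  rw [mul_div_assoc', le_div_iff₀ hpi']
  nlinarith [hε.1]

/-! ### The Poisson kernel in Stolz regions -/

/-- The Poisson kernel of the unit disc. -/
noncomputable def poisson (z : ℂ) (ζ : Circle) : ℝ := (((ζ : ℂ) + z) / ((ζ : ℂ) - z)).re

theorem poisson_eq (z : ℂ) (ζ : Circle) :
    poisson z ζ = (1 - ‖z‖ ^ 2) / ‖(ζ : ℂ) - z‖ ^ 2 := by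
  have h := congrFun (poissonKernel_eq_re_herglotzRieszKernel (c := 0) (w := z)) (ζ : ℂ)
  rw [poissonKernel_def] at h
  simp only [Function.comp_apply, herglotzRieszKernel_def, sub_zero, Circle.norm_coe, one_pow] at h
  exact h.symm

theorem poisson_nonneg {z : ℂ} (hz : ‖z‖ < 1) (ζ : Circle) : 0 ≤ poisson z ζ := by
  rw [poisson_eq]
  have : ‖z‖ ^ 2 ≤ 1 := pow_le_one₀ (norm_nonneg z) hz.le
  exact div_nonneg (by linarith) (by positivity)

theorem one_sub_norm_le (z : ℂ) (ζ : Circle) : 1 - ‖z‖ ≤ ‖(ζ : ℂ) - z‖ := by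
  have := norm_sub_norm_le (ζ : ℂ) z
  rwa [Circle.norm_coe] at this

theorem coe_sub_ne_zero {z : ℂ} (hz : ‖z‖ < 1) (ζ : Circle) : (ζ : ℂ) - z ≠ 0 := by
  have := one_sub_norm_le z ζ
  exact norm_pos_iff.1 (by linarith)

theorem continuous_herglotz_kernel {z : ℂ} (hz : ‖z‖ < 1) :
    Continuous fun ζ : Circle => ((ζ : ℂ) + z) / ((ζ : ℂ) - z) :=
  (by fun_prop : Continuous fun ζ : Circle => (ζ : ℂ) + z).div (by fun_prop)
    fun ζ => coe_sub_ne_zero hz ζ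

theorem continuous_poisson {z : ℂ} (hz : ‖z‖ < 1) : Continuous (poisson z) :=
  Complex.continuous_re.comp (continuous_herglotz_kernel hz)

theorem dist_circle_eq (ζ η : Circle) : dist ζ η = ‖(ζ : ℂ) - η‖ := by
  change dist (ζ : ℂ) (η : ℂ) = _
  rw [dist_eq_norm]

theorem poisson_le_inv {z : ℂ} (hz : ‖z‖ < 1) (ζ : Circle) :
    poisson z ζ ≤ 2 / (1 - ‖z‖) := by
  rw [poisson_eq]
  have h := one_sub_norm_le z ζ
  have hn := norm_nonneg z
  have hs : 0 < 1 - ‖z‖ := by linarith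
  rw [div_le_div_iff₀ (by nlinarith) hs]
  nlinarith [mul_self_nonneg ‖(ζ : ℂ) - z‖, mul_self_le_mul_self hs.le h]

/-- In the Stolz region `|z - η| ≤ t (1 - |z|) ≤ t |ζ - z|`, hence `|ζ - η| ≤ (1 + t) |ζ - z|`: the
distance to `z` may be replaced by the distance to `η`. -/
theorem poisson_le_of_mem_stolz {t : ℝ} {η : Circle} {z : ℂ} (hz : z ∈ stolz t η) (ζ : Circle)
    (hζ : ζ ≠ η) : poisson z ζ ≤ 2 * (1 + t) ^ 2 * (1 - ‖z‖) / dist ζ η ^ 2 := by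
  have h := one_sub_norm_le z ζ
  have hn := norm_nonneg z
  have hs : 0 < 1 - ‖z‖ := by linarith [hz.1]
  have hρ : 0 < dist ζ η := dist_pos.2 hζ
  have ht : 0 ≤ t := by
    by_contra! ht
    have := hz.2
    have := norm_nonneg (z - (η : ℂ))
    nlinarith
  have h1 : dist ζ η ≤ (1 + t) * ‖(ζ : ℂ) - z‖ := by
    rw [dist_circle_eq]
    calc ‖(ζ : ℂ) - η‖ = ‖((ζ : ℂ) - z) + (z - η)‖ := by ring_nf
      _ ≤ ‖(ζ : ℂ) - z‖ + ‖z - η‖ := norm_add_le _ _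
      _ ≤ ‖(ζ : ℂ) - z‖ + t * (1 - ‖z‖) := by linarith [hz.2]
      _ ≤ ‖(ζ : ℂ) - z‖ + t * ‖(ζ : ℂ) - z‖ := by gcongr
      _ = _ := by ring
  rw [poisson_eq, div_le_div_iff₀ (by nlinarith) (by positivity)]
  have h2 : dist ζ η ^ 2 ≤ (1 + t) ^ 2 * ‖(ζ : ℂ) - z‖ ^ 2 := by
    rw [← mul_pow]; gcongr
  calc (1 - ‖z‖ ^ 2) * dist ζ η ^ 2
      ≤ (2 * (1 - ‖z‖)) * ((1 + t) ^ 2 * ‖(ζ : ℂ) - z‖ ^ 2) := by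
        gcongr
        nlinarith
    _ = _ := by ring

/-- On the dyadic ring of radius about `2 ^ k (1 - |z|)` the kernel decays like `4 ^ (-k) / (1 -
|z|)`. One factor `2 ^ (-k)` normalizes by the radius of the ball and the other makes the series
over `k` converge. In the constant, `2` serves the central ball and `8 (1 + t) ^ 2` the rings. -/
theorem exists_poisson_le_of_mem_stolz {t : ℝ} {η : Circle} {z : ℂ} (hz : z ∈ stolz t η)
    (ζ : Circle) : ∃ k : ℕ, ζ ∈ closedBall η (2 ^ k * (1 - ‖z‖)) ∧
      poisson z ζ ≤ (2 + 8 * (1 + t) ^ 2) * (1 / 2) ^ k / (2 ^ k * (1 - ‖z‖)) := by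
  have hs : 0 < 1 - ‖z‖ := by linarith [hz.1]
  rcases le_or_gt (dist ζ η) (1 - ‖z‖) with h | h
  · refine ⟨0, by simpa using h, (poisson_le_inv hz.1 ζ).trans ?_⟩
    simp only [pow_zero, mul_one, one_mul]
    gcongr
    nlinarith [sq_nonneg (1 + t)]
  · obtain ⟨k, hk1, hk2⟩ := exists_nat_pow_near ((one_le_div hs).2 h.le) one_lt_two
    rw [le_div_iff₀ hs] at hk1
    rw [div_lt_iff₀ hs] at hk2
    refine ⟨k + 1, hk2.le, ?_⟩
    have hne : ζ ≠ η := by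
      rintro rfl
      rw [dist_self] at h
      linarith
    refine (poisson_le_of_mem_stolz hz ζ hne).trans ?_
    have h4 : (2 ^ k * (1 - ‖z‖)) ^ 2 ≤ dist ζ η ^ 2 := by gcongr
    calc 2 * (1 + t) ^ 2 * (1 - ‖z‖) / dist ζ η ^ 2
        ≤ 2 * (1 + t) ^ 2 * (1 - ‖z‖) / (2 ^ k * (1 - ‖z‖)) ^ 2 := by gcongr
      _ = (8 * (1 + t) ^ 2) * (1 / 2) ^ (k + 1) / (2 ^ (k + 1) * (1 - ‖z‖)) := by
        rw [one_div_pow]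
        field_simp
        ring
      _ ≤ _ := by
        gcongr
        linarith

theorem lintegral_poisson_le {t : ℝ} {η : Circle} {z : ℂ} (hz : z ∈ stolz t η)
    (κ : Measure Circle) :
    ∫⁻ ζ, ENNReal.ofReal (poisson z ζ) ∂κ ≤
      ∑' k : ℕ, ENNReal.ofReal ((2 + 8 * (1 + t) ^ 2) * (1 / 2) ^ k) *
        (κ (closedBall η (2 ^ k * (1 - ‖z‖))) / ENNReal.ofReal (2 ^ k * (1 - ‖z‖))) := by
  have hs : 0 < 1 - ‖z‖ := by linarith [hz.1]
  calc ∫⁻ ζ, ENNReal.ofReal (poisson z ζ) ∂κ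
      ≤ ∫⁻ ζ, ∑' k : ℕ, (closedBall η (2 ^ k * (1 - ‖z‖))).indicator (fun _ =>
          ENNReal.ofReal ((2 + 8 * (1 + t) ^ 2) * (1 / 2) ^ k) /
            ENNReal.ofReal (2 ^ k * (1 - ‖z‖))) ζ ∂κ := by
        refine lintegral_mono fun ζ => ?_
        obtain ⟨k, hk, hle⟩ := exists_poisson_le_of_mem_stolz hz ζ
        refine le_trans ?_ (ENNReal.le_tsum k)
        rw [Set.indicator_of_mem hk, ← ENNReal.ofReal_div_of_pos (by positivity)]
        exact ENNReal.ofReal_le_ofReal hle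
    _ = _ := by
        rw [lintegral_tsum fun k =>
          (measurable_const.indicator measurableSet_closedBall).aemeasurable]
        congr with k
        rw [lintegral_indicator_const measurableSet_closedBall]
        simp only [div_eq_mul_inv]
        ring

theorem tendsto_lintegral_poisson_stolz (κ : Measure Circle) [IsFiniteMeasure κ] (η : Circle)
    (h : Tendsto (fun δ => κ (closedBall η δ) / ENNReal.ofReal δ) (𝓝[>] 0) (𝓝 0)) (t : ℝ) :
    Tendsto (fun z => ∫⁻ ζ, ENNReal.ofReal (poisson z ζ) ∂κ) (𝓝[stolz t η] (η : ℂ)) (𝓝 0) := by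
  set φ : ℝ → ENNReal := fun δ => κ (closedBall η δ) / ENNReal.ofReal δ with hφ
  -- Small radii are controlled by the hypothesis, large ones by the total mass of `κ`.
  obtain ⟨K, hK, hφK⟩ : ∃ K : ENNReal, K ≠ ⊤ ∧ ∀ δ : ℝ, 0 < δ → φ δ ≤ K := by
    have h1 : ∀ᶠ δ in 𝓝[>] (0 : ℝ), φ δ < 1 := h.eventually (gt_mem_nhds one_pos)
    obtain ⟨δ₀, hδ₀, hsub⟩ := mem_nhdsGT_iff_exists_Ioc_subset.1 h1
    have hδ₀' : (0 : ℝ) < δ₀ := hδ₀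
    refine ⟨1 + κ Set.univ / ENNReal.ofReal δ₀, ?_, fun δ hδ => ?_⟩
    · exact ENNReal.add_ne_top.2 ⟨ENNReal.one_ne_top,
        ENNReal.div_ne_top (measure_ne_top _ _) (by simpa using hδ₀')⟩
    · rcases le_total δ δ₀ with hle | hle
      · exact (le_of_lt (hsub ⟨hδ, hle⟩)).trans le_self_add
      · refine le_trans ?_ le_add_self
        exact ENNReal.div_le_div (measure_mono (Set.subset_univ _)) (ENNReal.ofReal_le_ofReal hle)
  have hsum : ∑' k : ℕ, ENNReal.ofReal ((2 + 8 * (1 + t) ^ 2) * (1 / 2) ^ k) * K ≠ ⊤ := by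
    rw [ENNReal.tsum_mul_right]
    refine ENNReal.mul_ne_top ?_ hK
    rw [← ENNReal.ofReal_tsum_of_nonneg (fun k => by positivity)
      ((summable_geometric_of_lt_one (by norm_num) (by norm_num)).mul_left _)]
    exact ENNReal.ofReal_ne_top
  have hmem : ∀ᶠ z in 𝓝[stolz t η] (η : ℂ), z ∈ stolz t η := self_mem_nhdsWithin
  have hrad : Tendsto (fun z : ℂ => 1 - ‖z‖) (𝓝[stolz t η] (η : ℂ)) (𝓝 0) := by
    have : Tendsto (fun z : ℂ => 1 - ‖z‖) (𝓝 (η : ℂ)) (𝓝 (1 - ‖(η : ℂ)‖)) :=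
      (by fun_prop : Continuous fun z : ℂ => 1 - ‖z‖).tendsto _
    rw [Circle.norm_coe, sub_self] at this
    exact this.mono_left nhdsWithin_le_nhds
  have hlim : Tendsto (fun z : ℂ => ∑' k : ℕ,
      ENNReal.ofReal ((2 + 8 * (1 + t) ^ 2) * (1 / 2) ^ k) * φ (2 ^ k * (1 - ‖z‖)))
      (𝓝[stolz t η] (η : ℂ)) (𝓝 0) := by
    -- The series is read as an integral for counting measure, so that dominated convergence applies
    -- with majorant `C 2 ^ (-k) K`.
    simp_rw [← lintegral_count]
    rw [← lintegral_zero (μ := (Measure.count : Measure ℕ))]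
    refine tendsto_lintegral_filter_of_dominated_convergence
      (fun k : ℕ => ENNReal.ofReal ((2 + 8 * (1 + t) ^ 2) * (1 / 2) ^ k) * K)
      (Eventually.of_forall fun z => measurable_of_countable _) ?_ ?_ ?_
    · filter_upwards [hmem] with z hz
      refine Eventually.of_forall fun k => ?_
      have hs : 0 < 1 - ‖z‖ := by linarith [hz.1]
      exact mul_le_mul_right (hφK _ (by positivity)) _
    · rwa [lintegral_count]
    · refine Eventually.of_forall fun k => ?_
      have h1 : Tendsto (fun z : ℂ => 2 ^ k * (1 - ‖z‖)) (𝓝[stolz t η] (η : ℂ)) (𝓝[>] 0) := by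
        refine tendsto_nhdsWithin_iff.2 ⟨by simpa using hrad.const_mul (2 ^ k), ?_⟩
        filter_upwards [hmem] with z hz
        have hs : 0 < 1 - ‖z‖ := by linarith [hz.1]
        exact Set.mem_Ioi.2 (by positivity)
      have h2 := ENNReal.Tendsto.const_mul (a := ENNReal.ofReal ((2 + 8 * (1 + t) ^ 2) *
        (1 / 2) ^ k)) (h.comp h1) (Or.inr ENNReal.ofReal_ne_top)
      rwa [mul_zero] at h2
  refine tendsto_of_tendsto_of_tendsto_of_le_of_le' tendsto_const_nhds hlim
    (Eventually.of_forall fun _ => zero_le) ?_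
  filter_upwards [hmem] with z hz
  exact lintegral_poisson_le hz κ

theorem tendsto_nontangential_iff {X : Type*} {f : ℂ → X} {l : Filter X} {η : Circle} :
    Tendsto f (nontangential η) l ↔ ∀ t : ℝ, 1 < t → Tendsto f (𝓝[stolz t η] (η : ℂ)) l := by
  simp [nontangential, tendsto_iSup]

theorem tendsto_lintegral_poisson_nontangential (κ : Measure Circle) [IsFiniteMeasure κ]
    (η : Circle)
    (h : Tendsto (fun δ => κ (closedBall η δ) / ENNReal.ofReal δ) (𝓝[>] 0) (𝓝 0)) :
    Tendsto (fun z => ∫⁻ ζ, ENNReal.ofReal (poisson z ζ) ∂κ) (nontangential η) (𝓝 0) :=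
  tendsto_nontangential_iff.2 fun t _ => tendsto_lintegral_poisson_stolz κ η h t

/-- Radii lie in the Stolz region of aperture `2`, as `|r η - η| = 1 - r`. This makes non-tangential
limits unique and lets them be tested along radial sequences. -/
theorem tendsto_radial (η : Circle) :
    Tendsto (fun r : ℝ => (r : ℂ) * η) (𝓝[<] 1) (nontangential η) := by
  have h1 : Tendsto (fun r : ℝ => (r : ℂ) * η) (𝓝[<] 1) (𝓝[stolz 2 η] (η : ℂ)) := by
    refine tendsto_nhdsWithin_iff.2 ⟨?_, ?_⟩
    · have : Tendsto (fun r : ℝ => (r : ℂ) * η) (𝓝 1) (𝓝 (((1 : ℝ) : ℂ) * η)) :=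
        (by fun_prop : Continuous fun r : ℝ => (r : ℂ) * η).tendsto _
      rw [Complex.ofReal_one, one_mul] at this
      exact this.mono_left nhdsWithin_le_nhds
    · filter_upwards [Ioo_mem_nhdsLT (show (0 : ℝ) < 1 by norm_num)] with r hr
      have hn : ‖(r : ℂ) * η‖ = r := by
        rw [norm_mul, Circle.norm_coe, mul_one, Complex.norm_real, Real.norm_of_nonneg hr.1.le]
      have hd : ‖(r : ℂ) * η - η‖ = 1 - r := by
        rw [show (r : ℂ) * η - η = ((r - 1 : ℝ) : ℂ) * η by push_cast; ring, norm_mul,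
          Circle.norm_coe, mul_one, Complex.norm_real, Real.norm_of_nonpos (by linarith [hr.2])]
        ring
      exact ⟨by rw [hn]; exact hr.2, by rw [hn, hd]; linarith [hr.2]⟩
  refine h1.mono_right ?_
  exact le_iSup₂_of_le 2 one_lt_two le_rfl

instance nontangential_neBot (η : Circle) : (nontangential η).NeBot := (tendsto_radial η).neBot

theorem eventually_nontangential_norm_lt_one (η : Circle) :
    ∀ᶠ z in nontangential η, ‖z‖ < 1 := by
  simp only [nontangential, eventually_iSup]
  intro t _
  filter_upwards [self_mem_nhdsWithin] with z hz using hz.1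

/-! ### Fatou's theorem for Poisson integrals of measures -/

theorem tendsto_measure_div_ofReal (κ : Measure Circle) (η : Circle)
    (h : Tendsto (fun δ => κ (closedBall η δ) / circleMeasure (closedBall η δ)) (𝓝[>] 0) (𝓝 0)) :
    Tendsto (fun δ => κ (closedBall η δ) / ENNReal.ofReal δ) (𝓝[>] 0) (𝓝 0) := by
  refine tendsto_of_tendsto_of_tendsto_of_le_of_le tendsto_const_nhds h (fun _ => zero_le)
    fun δ => ?_
  exact ENNReal.div_le_div_left (circleMeasure_closedBall_le η δ) _

theorem tendsto_closedBall_vitaliFamily (η : Circle) :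
    Tendsto (fun δ : ℝ => closedBall η δ) (𝓝[>] 0)
      ((IsUnifLocDoublingMeasure.vitaliFamily circleMeasure 1).filterAt η) :=
  IsUnifLocDoublingMeasure.tendsto_closedBall_filterAt circleMeasure (fun _ => η) (fun δ => δ)
    tendsto_id (by
      filter_upwards [self_mem_nhdsWithin] with δ hδ
      exact mem_closedBall_self (by simpa using (Set.mem_Ioi.1 hδ).le))

theorem ae_tendsto_lintegral_poisson_of_mutuallySingular (κ : Measure Circle) [IsFiniteMeasure κ]
    (hκ : κ ⟂ₘ circleMeasure) : ∀ᵐ η ∂circleMeasure,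
      Tendsto (fun z => ∫⁻ ζ, ENNReal.ofReal (poisson z ζ) ∂κ) (nontangential η) (𝓝 0) := by
  filter_upwards [(IsUnifLocDoublingMeasure.vitaliFamily circleMeasure
    1).ae_eventually_measure_zero_of_singular hκ] with η hη
  exact tendsto_lintegral_poisson_nontangential κ η
    (tendsto_measure_div_ofReal κ η (hη.comp (tendsto_closedBall_vitaliFamily η)))

theorem ae_tendsto_lintegral_poisson_mul_enorm_sub {g : Circle → ℂ}
    (hg : Integrable g circleMeasure) : ∀ᵐ η ∂circleMeasure,
      Tendsto (fun z => ∫⁻ ζ, ENNReal.ofReal (poisson z ζ) * ‖g ζ - g η‖ₑ ∂circleMeasure)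
        (nontangential η) (𝓝 0) := by
  filter_upwards [(IsUnifLocDoublingMeasure.vitaliFamily circleMeasure
    1).ae_tendsto_lintegral_enorm_sub_div hg.locallyIntegrable] with η hη
  have hint : Integrable (fun ζ => g ζ - g η) circleMeasure := hg.sub (integrable_const _)
  have hm : AEMeasurable (fun ζ => ‖g ζ - g η‖ₑ) circleMeasure := hint.1.enorm
  -- The measure depends on the point `η`. That `η` is a Lebesgue point of `g` says exactly that `κ`
  -- has zero density at `η`.
  set κ := circleMeasure.withDensity fun ζ => ‖g ζ - g η‖ₑ with hκ
  have : IsFiniteMeasure κ := isFiniteMeasure_withDensity hint.2.ne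
  have h := hη.comp (tendsto_closedBall_vitaliFamily η)
  have h' : Tendsto (fun δ => κ (closedBall η δ) / circleMeasure (closedBall η δ))
      (𝓝[>] 0) (𝓝 0) := by
    refine h.congr fun δ => ?_
    rw [hκ, withDensity_apply _ measurableSet_closedBall]
    rfl
  refine (tendsto_lintegral_poisson_nontangential κ η (tendsto_measure_div_ofReal κ η h')).congr' ?_
  filter_upwards [eventually_nontangential_norm_lt_one η] with z hz
  rw [hκ, lintegral_withDensity_eq_lintegral_mul₀ hm
    (continuous_poisson hz).measurable.ennreal_ofReal.aemeasurable]
  simp only [Pi.mul_apply, mul_comm]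

theorem integrable_poisson_smul {τ : Measure Circle} {g : Circle → ℂ} (hg : Integrable g τ)
    {z : ℂ} (hz : ‖z‖ < 1) : Integrable (fun ζ => poisson z ζ • g ζ) τ := by
  refine hg.bdd_smul (2 / (1 - ‖z‖))
    (continuous_poisson hz).measurable.aestronglyMeasurable
    (Eventually.of_forall fun ζ => ?_)
  rw [Real.norm_of_nonneg (poisson_nonneg hz ζ)]
  exact poisson_le_inv hz ζ

theorem integral_poisson_smul_const {z : ℂ} (hz : ‖z‖ < 1) (c : ℂ) :
    ∫ ζ, poisson z ζ • c ∂circleMeasure = c := by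
  have h := DiffContOnCl.circleAverage_re_herglotzRieszKernel_smul' (c := 0) (R := 1) (w := z)
    (f := fun _ => c) diffContOnCl_const (by simpa using hz)
  rw [← integral_circleMeasure] at h
  simpa [poisson] using h

theorem enorm_integral_poisson_smul_le (τ : Measure Circle) (g : Circle → ℂ) {z : ℂ}
    (hz : ‖z‖ < 1) : ‖∫ ζ, poisson z ζ • g ζ ∂τ‖ₑ ≤
      ∫⁻ ζ, ENNReal.ofReal (poisson z ζ) * ‖g ζ‖ₑ ∂τ := by
  refine (enorm_integral_le_lintegral_enorm _).trans (le_of_eq ?_)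
  congr with ζ
  rw [enorm_smul, Real.enorm_of_nonneg (poisson_nonneg hz ζ)]

/-- The Poisson integral is dominated by that of the finite positive measure `|g| τ`, which is still
singular. -/
theorem ae_tendsto_integral_poisson_singular {τ : Measure Circle}
    (hτ : τ ⟂ₘ circleMeasure) {g : Circle → ℂ} (hg : Integrable g τ) :
    ∀ᵐ η ∂circleMeasure,
      Tendsto (fun z => ∫ ζ, poisson z ζ • g ζ ∂τ) (nontangential η) (𝓝 0) := by
  have : IsFiniteMeasure (τ.withDensity fun ζ => ‖g ζ‖ₑ) := isFiniteMeasure_withDensity hg.2.ne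
  filter_upwards [ae_tendsto_lintegral_poisson_of_mutuallySingular _
    (hτ.mono_ac (withDensity_absolutelyContinuous τ fun ζ => ‖g ζ‖ₑ) .rfl)] with η hη
  rw [tendsto_zero_iff_enorm_tendsto_zero]
  refine tendsto_of_tendsto_of_tendsto_of_le_of_le' tendsto_const_nhds hη
    (Eventually.of_forall fun _ => zero_le) ?_
  filter_upwards [eventually_nontangential_norm_lt_one η] with z hz
  refine (enorm_integral_poisson_smul_le τ g hz).trans (le_of_eq ?_)
  rw [lintegral_withDensity_eq_lintegral_mul₀ hg.1.enorm
    (continuous_poisson hz).measurable.ennreal_ofReal.aemeasurable]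
  simp only [Pi.mul_apply, mul_comm]

/-- Since the Poisson kernel has mass one, the error is the Poisson integral of `g - g η`, which
tends to zero at Lebesgue points. -/
theorem ae_tendsto_integral_poisson_circleMeasure {g : Circle → ℂ}
    (hg : Integrable g circleMeasure) : ∀ᵐ η ∂circleMeasure,
      Tendsto (fun z => ∫ ζ, poisson z ζ • g ζ ∂circleMeasure) (nontangential η) (𝓝 (g η)) := by
  filter_upwards [ae_tendsto_lintegral_poisson_mul_enorm_sub hg] with η hη
  rw [tendsto_iff_edist_tendsto_0]
  refine tendsto_of_tendsto_of_tendsto_of_le_of_le' tendsto_const_nhds hη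
    (Eventually.of_forall fun _ => zero_le) ?_
  filter_upwards [eventually_nontangential_norm_lt_one η] with z hz
  refine le_trans (le_of_eq ?_) (enorm_integral_poisson_smul_le circleMeasure
    (fun ζ => g ζ - g η) hz)
  simp_rw [smul_sub]
  rw [integral_sub (integrable_poisson_smul hg hz)
    (integrable_poisson_smul (integrable_const _) hz), integral_poisson_smul_const hz,
    edist_eq_enorm_sub]

/-- **Fatou's theorem**: the Poisson integral of a complex measure `g dτ` has non-tangential limit
equal to its Lebesgue density almost everywhere. -/
theorem ae_tendsto_integral_poisson {τ : Measure Circle} [IsFiniteMeasure τ] {g : Circle → ℂ}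
    (hg : Integrable g τ) : ∀ᵐ η ∂circleMeasure,
      Tendsto (fun z => ∫ ζ, poisson z ζ • g ζ ∂τ) (nontangential η)
        (𝓝 ((τ.rnDeriv circleMeasure η).toReal • g η)) := by
  have hdec := τ.haveLebesgueDecomposition_add circleMeasure
  have hs : Integrable g (τ.singularPart circleMeasure) :=
    hg.mono_measure (Measure.singularPart_le _ _)
  have ha : Integrable g (circleMeasure.withDensity (τ.rnDeriv circleMeasure)) :=
    hg.mono_measure (Measure.withDensity_rnDeriv_le _ _)
  have hm := Measure.measurable_rnDeriv τ circleMeasure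
  have hlt := Measure.rnDeriv_lt_top τ circleMeasure
  have hG : Integrable (fun ζ => (τ.rnDeriv circleMeasure ζ).toReal • g ζ) circleMeasure :=
    (integrable_withDensity_iff_integrable_smul' hm hlt).1 ha
  filter_upwards [ae_tendsto_integral_poisson_singular
    (Measure.mutuallySingular_singularPart τ circleMeasure) hs,
    ae_tendsto_integral_poisson_circleMeasure hG] with η h1 h2
  have h3 := h1.add h2
  rw [zero_add] at h3
  refine h3.congr' ?_
  filter_upwards [eventually_nontangential_norm_lt_one η] with z hz
  conv_rhs => rw [hdec]
  rw [integral_add_measure (integrable_poisson_smul hs hz) (integrable_poisson_smul ha hz),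
    integral_withDensity_eq_integral_toReal_smul hm hlt]
  congr 2 with ζ
  rw [smul_comm]

/-! ### Boundary values of bounded holomorphic functions -/

/-- A bounded sequence in a Hilbert space has a weak cluster point. -/
theorem exists_weak_cluster_point {H : Type*} [NormedAddCommGroup H] [InnerProductSpace ℂ H]
    [CompleteSpace H] {u : ℕ → H} {C : ℝ} (hu : ∀ k, ‖u k‖ ≤ C) :
    ∃ G : H, ∀ (v : H) (c : ℂ), Tendsto (fun k => inner ℂ (u k) v) atTop (𝓝 c) →
      inner ℂ G v = c := by
  set x : ℕ → WeakDual ℂ H := fun k =>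
    StrongDual.toWeakDual (InnerProductSpace.toDual ℂ H (u k)) with hx
  have hcomp := WeakDual.isCompact_closedBall (0 : StrongDual ℂ H) C
  have hmem : ∀ k, x k ∈ WeakDual.toStrongDual ⁻¹' closedBall (0 : StrongDual ℂ H) C := by
    intro k
    simpa [hx] using hu k
  -- Banach–Alaoglu along a free ultrafilter replaces extraction of a subsequence. The ultrafilter
  -- refines `atTop`, so every limit that exists along the sequence is kept.
  obtain ⟨Λ, -, hΛ⟩ := hcomp.ultrafilter_le_nhds ((hyperfilter ℕ).map x) (by
    rw [le_principal_iff]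
    exact mem_map.2 (univ_mem' hmem))
  refine ⟨(InnerProductSpace.toDual ℂ H).symm (WeakDual.toStrongDual Λ), fun v c hv => ?_⟩
  rw [InnerProductSpace.toDual_symm_apply]
  have h1 : Tendsto (fun k => x k v) (hyperfilter ℕ : Filter ℕ) (𝓝 (Λ v)) :=
    ((WeakDual.eval_continuous v).tendsto Λ).comp hΛ
  have h2 : Tendsto (fun k => x k v) (hyperfilter ℕ : Filter ℕ) (𝓝 c) :=
    hv.mono_left Nat.hyperfilter_le_atTop
  exact tendsto_nhds_unique h1 h2

/-- A sequence of radii increasing to `1`. -/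
noncomputable def radius (k : ℕ) : ℝ := 1 - 1 / ((k : ℝ) + 2)

theorem radius_pos (k : ℕ) : 0 < radius k := by
  have hk : (0 : ℝ) < (k : ℝ) + 2 := by positivity
  rw [radius, sub_pos, div_lt_one hk]
  linarith [Nat.cast_nonneg (α := ℝ) k]

theorem radius_lt_one (k : ℕ) : radius k < 1 := by
  have : (0 : ℝ) < 1 / ((k : ℝ) + 2) := by positivity
  rw [radius]
  linarith

theorem tendsto_radius : Tendsto radius atTop (𝓝 1) := by
  have h : Tendsto (fun k : ℕ => 1 / ((k : ℝ) + 2)) atTop (𝓝 0) := by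
    have := tendsto_one_div_add_atTop_nhds_zero_nat (𝕜 := ℝ)
    have := this.comp (tendsto_add_atTop_nat 1)
    refine this.congr fun k => ?_
    simp only [Function.comp_apply]
    push_cast
    ring_nf
  have h1 := h.const_sub 1
  rw [sub_zero] at h1
  exact h1

theorem tendsto_radius_nhdsLT : Tendsto radius atTop (𝓝[<] 1) :=
  tendsto_nhdsWithin_iff.2 ⟨tendsto_radius, Eventually.of_forall radius_lt_one⟩

theorem norm_radius_mul_lt {k : ℕ} {z : ℂ} (hz : ‖z‖ ≤ 1) : ‖(radius k : ℂ) * z‖ < 1 := by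
  rw [norm_mul, Complex.norm_real, Real.norm_of_nonneg (radius_pos k).le]
  exact (mul_le_of_le_one_right (radius_pos k).le hz).trans_lt (radius_lt_one k)

theorem diffContOnCl_dilation {f : ℂ → ℂ} (hf : DifferentiableOn ℂ f (ball 0 1)) (k : ℕ) :
    DiffContOnCl ℂ (fun w => f (radius k * w)) (ball 0 1) := by
  refine DifferentiableOn.diffContOnCl ?_
  rw [closure_ball (0 : ℂ) one_ne_zero]
  refine hf.comp (by fun_prop) fun w hw => ?_
  rw [mem_ball_zero_iff]
  exact norm_radius_mul_lt (by simpa using hw)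

theorem continuous_dilation_circle {f : ℂ → ℂ} (hf : DifferentiableOn ℂ f (ball 0 1)) (k : ℕ) :
    Continuous fun ζ : Circle => f (radius k * ζ) := by
  refine hf.continuousOn.comp_continuous (by fun_prop) fun ζ => ?_
  rw [mem_ball_zero_iff]
  exact norm_radius_mul_lt (Circle.norm_coe ζ).le

theorem integral_poisson_dilation {f : ℂ → ℂ} (hf : DifferentiableOn ℂ f (ball 0 1)) (k : ℕ)
    {z : ℂ} (hz : ‖z‖ < 1) :
    ∫ ζ : Circle, poisson z ζ • f (radius k * ζ) ∂circleMeasure = f (radius k * z) := by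
  have h := DiffContOnCl.circleAverage_re_herglotzRieszKernel_smul'
    (diffContOnCl_dilation hf k) (w := z) (by simpa using hz)
  rw [← integral_circleMeasure] at h
  simpa [poisson] using h

/-- The dilations `f (r_k ζ)` are bounded in `L²` and satisfy the Poisson formula. A weak cluster
point `G`, tested against the Poisson kernel at `z`, yields the limit `f z` of `f (r_k z)`. -/
theorem exists_poisson_representation {f : ℂ → ℂ} {M : ℝ}
    (hf : DifferentiableOn ℂ f (ball 0 1)) (hM : ∀ z ∈ ball (0 : ℂ) 1, ‖f z‖ ≤ M) :
    ∃ G : Circle → ℂ, Integrable G circleMeasure ∧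
      ∀ z : ℂ, ‖z‖ < 1 → f z = ∫ ζ, poisson z ζ • G ζ ∂circleMeasure := by
  have hbd : ∀ k, ∀ ζ : Circle, ‖f (radius k * ζ)‖ ≤ M := fun k ζ => hM _ (by
    rw [mem_ball_zero_iff]
    exact norm_radius_mul_lt (Circle.norm_coe ζ).le)
  have hmem : ∀ k, MemLp (fun ζ : Circle => f (radius k * ζ)) 2 circleMeasure := fun k =>
    MemLp.of_bound (continuous_dilation_circle hf k).measurable.aestronglyMeasurable M
      (Eventually.of_forall (hbd k))
  have hM0 : 0 ≤ M := (norm_nonneg _).trans (hbd 0 1)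
  obtain ⟨G, hG⟩ := exists_weak_cluster_point (u := fun k => (hmem k).toLp) (C := M) (by
    intro k
    refine (Lp.norm_le_of_ae_bound hM0 ?_).trans (le_of_eq (b := M) ?_)
    · filter_upwards [(hmem k).coeFn_toLp] with ζ hζ
      rw [hζ]
      exact hbd k ζ
    · simp [measureUnivNNReal])
  refine ⟨G, (Lp.memLp G).integrable one_le_two, fun z hz => ?_⟩
  have hP : MemLp (fun ζ : Circle => (poisson z ζ : ℂ)) 2 circleMeasure := by
    refine MemLp.of_bound (Complex.continuous_ofReal.comp
      (continuous_poisson hz)).measurable.aestronglyMeasurable (2 / (1 - ‖z‖))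
      (Eventually.of_forall fun ζ => ?_)
    rw [Complex.norm_real, Real.norm_of_nonneg (poisson_nonneg hz ζ)]
    exact poisson_le_inv hz ζ
  have hinner : ∀ w : Lp ℂ 2 circleMeasure, inner ℂ w hP.toLp
      = (starRingEnd ℂ) (∫ ζ, poisson z ζ • w ζ ∂circleMeasure) := by
    intro w
    rw [L2.inner_def, ← integral_conj]
    refine integral_congr_ae ?_
    filter_upwards [hP.coeFn_toLp] with ζ hζ
    rw [hζ, RCLike.inner_apply, Complex.real_smul, map_mul, Complex.conj_ofReal]
  have hlim := hG hP.toLp ((starRingEnd ℂ) (f z)) (by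
    have hcont : Tendsto (fun k => (starRingEnd ℂ) (f (radius k * z))) atTop
        (𝓝 ((starRingEnd ℂ) (f z))) := by
      have h1 : ContinuousAt f z :=
        (hf.continuousOn).continuousAt (isOpen_ball.mem_nhds (by simpa using hz))
      have h2 : Tendsto (fun k => (radius k : ℂ) * z) atTop (𝓝 z) := by
        have := (Complex.continuous_ofReal.tendsto 1).comp tendsto_radius
        simpa using this.mul_const z
      exact (Complex.continuous_conj.tendsto _).comp (h1.tendsto.comp h2)
    refine hcont.congr fun k => ?_
    rw [hinner, ← integral_poisson_dilation hf k hz]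
    congr 1
    refine integral_congr_ae ?_
    filter_upwards [(hmem k).coeFn_toLp] with ζ hζ
    rw [hζ])
  rw [hinner] at hlim
  exact ((starRingEnd ℂ).injective hlim).symm

/-- **Fatou's theorem** for bounded holomorphic functions. -/
theorem ae_exists_tendsto_nontangential {f : ℂ → ℂ} {M : ℝ}
    (hf : DifferentiableOn ℂ f (ball 0 1)) (hM : ∀ z ∈ ball (0 : ℂ) 1, ‖f z‖ ≤ M) :
    ∀ᵐ η ∂circleMeasure, ∃ l, Tendsto f (nontangential η) (𝓝 l) := by
  obtain ⟨G, hG, hrep⟩ := exists_poisson_representation hf hM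
  filter_upwards [ae_tendsto_integral_poisson_circleMeasure hG] with η hη
  refine ⟨G η, hη.congr' ?_⟩
  filter_upwards [eventually_nontangential_norm_lt_one η] with z hz
  exact (hrep z hz).symm

/-- Without zeros `log |f|` is harmonic, so its circle means all equal its value at the centre. The
bound `|f| ≤ 1` gives `-log |f|` a sign, which turns the mean into a lower integral fit for Fatou's
lemma. -/
theorem lintegral_neg_log_dilation {f : ℂ → ℂ} (hf : DifferentiableOn ℂ f (ball 0 1))
    (hM : ∀ z ∈ ball (0 : ℂ) 1, ‖f z‖ ≤ 1) (h0 : ∀ z ∈ ball (0 : ℂ) 1, f z ≠ 0) (k : ℕ) :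
    ∫⁻ ζ : Circle, ENNReal.ofReal (-Real.log ‖f (radius k * ζ)‖) ∂circleMeasure
      = ENNReal.ofReal (-Real.log ‖f 0‖) := by
  have hball : ∀ z : ℂ, ‖z‖ ≤ 1 → (radius k : ℂ) * z ∈ ball (0 : ℂ) 1 := fun z hz => by
    rw [mem_ball_zero_iff]
    exact norm_radius_mul_lt hz
  have hcirc : ∀ ζ : Circle, (radius k : ℂ) * ζ ∈ ball (0 : ℂ) 1 := fun ζ =>
    hball _ (Circle.norm_coe ζ).le
  have hlog : Continuous fun ζ : Circle => -Real.log ‖f (radius k * ζ)‖ :=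
    ((continuous_dilation_circle hf k).norm.log
      fun ζ => norm_ne_zero_iff.2 (h0 _ (hcirc ζ))).neg
  rw [← ofReal_integral_eq_lintegral_ofReal]
  · congr 1
    rw [integral_neg, integral_circleMeasure (fun w : ℂ => Real.log ‖f (radius k * w)‖)]
    rw [AnalyticOnNhd.circleAverage_log_norm_of_ne_zero (g := fun w => f (radius k * w))]
    · simp
    · intro w hw
      refine AnalyticAt.fun_comp (g := f) ?_ (by fun_prop)
      exact hf.analyticAt (isOpen_ball.mem_nhds (hball w (by simpa using hw)))
    · intro w hw
      exact h0 _ (hball w (by simpa using hw))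
  · exact hlog.integrable_of_hasCompactSupport (HasCompactSupport.of_compactSpace _)
  · refine Eventually.of_forall fun ζ => ?_
    simpa using Real.log_nonpos (norm_nonneg _) (hM _ (hcirc ζ))

/-- The non-tangential limits of a bounded zero-free holomorphic function vanish almost
nowhere. -/
theorem ae_limit_ne_zero {f : ℂ → ℂ} {M : ℝ} (hf : DifferentiableOn ℂ f (ball 0 1))
    (hM : ∀ z ∈ ball (0 : ℂ) 1, ‖f z‖ ≤ M) (h0 : ∀ z ∈ ball (0 : ℂ) 1, f z ≠ 0) :
    ∀ᵐ η ∂circleMeasure, ¬ Tendsto f (nontangential η) (𝓝 0) := by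
  have hMpos : 0 < M :=
    (norm_pos_iff.2 (h0 0 (mem_ball_self one_pos))).trans_le (hM 0 (mem_ball_self one_pos))
  wlog hM1 : M = 1 generalizing f M
  · have h := this (f := fun z => (M : ℂ)⁻¹ * f z) (M := 1) (hf.const_mul _)
      (fun z hz => by
        rw [norm_mul, norm_inv, Complex.norm_real, Real.norm_of_nonneg hMpos.le,
          inv_mul_le_one₀ hMpos]
        exact hM z hz)
      (fun z hz => mul_ne_zero (inv_ne_zero (by exact_mod_cast hMpos.ne')) (h0 z hz))
      one_pos rfl
    filter_upwards [h] with η hη hlim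
    exact hη (by simpa using hlim.const_mul (M : ℂ)⁻¹)
  subst hM1
  have hcirc : ∀ k, ∀ ζ : Circle, (radius k : ℂ) * ζ ∈ ball (0 : ℂ) 1 := fun k ζ => by
    rw [mem_ball_zero_iff]
    exact norm_radius_mul_lt (Circle.norm_coe ζ).le
  have hmeas : ∀ k, Measurable fun ζ : Circle =>
      ENNReal.ofReal (-Real.log ‖f (radius k * ζ)‖) := fun k =>
    ((continuous_dilation_circle hf k).norm.log
      fun ζ => norm_ne_zero_iff.2 (h0 _ (hcirc k ζ))).neg.measurable.ennreal_ofReal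
  -- By Fatou's lemma the liminf of `-log |f (r_k η)|` has finite integral, hence is finite almost
  -- everywhere; limit zero at `η` would make it infinite.
  have hfat := lintegral_liminf_le (μ := circleMeasure) (u := atTop) hmeas
  simp_rw [lintegral_neg_log_dilation hf hM h0] at hfat
  rw [liminf_const] at hfat
  have hfin := ae_lt_top (Measurable.liminf hmeas) (hfat.trans_lt ENNReal.ofReal_lt_top).ne
  filter_upwards [hfin] with η hη hlim
  have h1 : Tendsto (fun k => ‖f (radius k * η)‖) atTop (𝓝[>] 0) := by
    refine tendsto_nhdsWithin_iff.2 ⟨?_, Eventually.of_forall fun k =>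
      norm_pos_iff.2 (h0 _ (hcirc k η))⟩
    simpa using (hlim.comp ((tendsto_radial η).comp tendsto_radius_nhdsLT)).norm
  have h2 := ENNReal.tendsto_ofReal_atTop.comp
    (tendsto_neg_atBot_atTop.comp (Real.tendsto_log_nhdsGT_zero.comp h1))
  exact hη.ne h2.liminf_eq

/-! ### Integration against matrix-valued measures -/

/-- Both sides agree on simple functions. Bounded simple approximations and dominated convergence on
each side extend this to `f`, the variation `|g| τ` being finite. -/
theorem integral_withDensityᵥ_mul {X : Type*} [MeasurableSpace X] {τ : Measure X} {g : X → ℂ}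
    (hg : Integrable g τ) {f : X → ℂ} (hf : StronglyMeasurable f) {C : ℝ} (hC0 : 0 ≤ C)
    (hC : ∀ x, ‖f x‖ ≤ C) :
    VectorMeasure.integral (τ.withDensityᵥ g) f (ContinuousLinearMap.mul ℝ ℂ)
      = ∫ x, f x * g x ∂τ := by
  have hvar := Measure.variation_withDensityᵥ hg
  have hfin : IsFiniteMeasure (τ.withDensityᵥ g).variation := by
    rw [hvar]
    exact isFiniteMeasure_withDensity hg.2.ne
  have hsimple : ∀ φ : SimpleFunc X ℂ,
      VectorMeasure.integral (τ.withDensityᵥ g) φ (ContinuousLinearMap.mul ℝ ℂ)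
        = ∫ x, φ x * g x ∂τ := by
    intro φ
    induction φ using SimpleFunc.induction with
    | @const c s hs =>
      have h1 : (⇑(SimpleFunc.piecewise s hs (SimpleFunc.const X c) (SimpleFunc.const X 0)))
          = s.indicator fun _ => c := by
        ext x
        simp
        rfl
      rw [h1, VectorMeasure.integral_indicator_const c hs, withDensityᵥ_apply hg hs,
        ContinuousLinearMap.mul_apply', ← integral_const_mul, ← integral_indicator hs]
      congr with x
      by_cases hx : x ∈ s <;> simp [hx]
    | @add φ ψ _ hφ hψ =>
      rw [SimpleFunc.coe_add, VectorMeasure.integral_add (φ.integrable_of_isFiniteMeasure)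
        (ψ.integrable_of_isFiniteMeasure), hφ, hψ, ← integral_add]
      · congr with x
        simp [add_mul]
      · obtain ⟨c, hc⟩ := φ.exists_forall_norm_le
        exact hg.bdd_mul (c := c) φ.aestronglyMeasurable (Eventually.of_forall hc)
      · obtain ⟨c, hc⟩ := ψ.exists_forall_norm_le
        exact hg.bdd_mul (c := c) ψ.aestronglyMeasurable (Eventually.of_forall hc)
  have hlim : ∀ x, Tendsto (fun n => hf.approxBounded C n x) atTop (𝓝 (f x)) := fun x =>
    hf.tendsto_approxBounded_of_norm_le (hC x)
  have h1 := VectorMeasure.tendsto_integral_of_dominated_convergence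
    (μ := τ.withDensityᵥ g) (B := ContinuousLinearMap.mul ℝ ℂ)
    (f := f) (fun _ => C)
    (fun n => (hf.approxBounded C n).aestronglyMeasurable) (integrable_const _)
    (fun n => Eventually.of_forall fun x => hf.norm_approxBounded_le hC0 n x)
    (Eventually.of_forall hlim)
  have h2 := tendsto_integral_of_dominated_convergence (μ := τ)
    (F := fun n x => hf.approxBounded C n x * g x) (f := fun x => f x * g x)
    (fun x => C * ‖g x‖)
    (fun n => (hf.approxBounded C n).aestronglyMeasurable.mul hg.1) (hg.norm.const_mul C)
    (fun n => Eventually.of_forall fun x => by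
      rw [norm_mul]
      gcongr
      exact hf.norm_approxBounded_le hC0 n x)
    (Eventually.of_forall fun x => (hlim x).mul_const _)
  refine tendsto_nhds_unique h1 (h2.congr fun n => ?_)
  exact (hsimple _).symm

theorem withDensityᵥ_rnDeriv_eq_of_absolutelyContinuous {X : Type*} [MeasurableSpace X]
    (c : ComplexMeasure X) (τ : Measure X) [SigmaFinite τ]
    (h : VectorMeasure.AbsolutelyContinuous c τ.toENNRealVectorMeasure) :
    τ.withDensityᵥ (c.rnDeriv τ) = c := by
  obtain ⟨hre, him⟩ := (ComplexMeasure.absolutelyContinuous_ennreal_iff c _).1 h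
  rw [SignedMeasure.absolutelyContinuous_iff_withDensityᵥ_rnDeriv_eq] at hre him
  have hi := c.integrable_rnDeriv τ
  ext s hs
  rw [withDensityᵥ_apply hi hs]
  apply Complex.ext
  · have := congrArg (fun v => v s) hre
    simp only [withDensityᵥ_apply (SignedMeasure.integrable_rnDeriv _ _) hs] at this
    refine Eq.trans ?_ this
    exact (integral_re hi.integrableOn).symm
  · have := congrArg (fun v => v s) him
    simp only [withDensityᵥ_apply (SignedMeasure.integrable_rnDeriv _ _) hs] at this
    refine Eq.trans ?_ this
    exact (integral_im hi.integrableOn).symm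

namespace PosMatrixMeasure

variable {n : ℕ} (μ : PosMatrixMeasure n)

theorem entry_apply (i j : Fin n) (s : Set Circle) :
    μ.entry i j s = μ.toVectorMeasure s i j := rfl

instance isFiniteMeasure_traceMeasure : IsFiniteMeasure μ.traceMeasure := by
  unfold traceMeasure
  infer_instance

/-- A positive semidefinite matrix of trace zero vanishes. -/
theorem entry_absolutelyContinuous (i j : Fin n) :
    VectorMeasure.AbsolutelyContinuous (μ.entry i j)
      μ.traceMeasure.toENNRealVectorMeasure := by
  refine VectorMeasure.AbsolutelyContinuous.mk fun s hs h0 => ?_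
  rw [Measure.toENNRealVectorMeasure_apply_measurable hs] at h0
  have h1 : μ.traceMeasure.real s = μ.traceSigned s := by
    rw [traceMeasure, SignedMeasure.toMeasureOfZeroLE_real_apply _ μ.traceSigned_nonneg _ hs,
      Set.univ_inter]
  rw [Measure.real, h0, ENNReal.toReal_zero, traceSigned_apply] at h1
  have hpsd := μ.posSemidef s
  have htr : (μ.toVectorMeasure s).trace = 0 := by
    have := Complex.le_def.1 hpsd.trace_nonneg
    exact Complex.ext h1.symm this.2.symm
  rw [entry_apply, hpsd.trace_eq_zero_iff.1 htr]
  rfl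

theorem withDensityᵥ_traceDensity (i j : Fin n) :
    μ.traceMeasure.withDensityᵥ (fun ζ => μ.traceDensity ζ i j) = μ.entry i j :=
  withDensityᵥ_rnDeriv_eq_of_absolutelyContinuous _ _ (μ.entry_absolutelyContinuous i j)

theorem integrable_traceDensity (i j : Fin n) :
    Integrable (fun ζ => μ.traceDensity ζ i j) μ.traceMeasure :=
  (μ.entry i j).integrable_rnDeriv μ.traceMeasure

/-- The values of the measure are Hermitian, and densities are determined almost everywhere by their
integrals over sets. -/
theorem ae_traceDensity_isHermitian (i j : Fin n) :
    ∀ᵐ ζ ∂μ.traceMeasure, (starRingEnd ℂ) (μ.traceDensity ζ j i) = μ.traceDensity ζ i j := by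
  have h1 := μ.integrable_traceDensity i j
  have h2 := μ.integrable_traceDensity j i
  have h3 : Integrable (fun ζ => (starRingEnd ℂ) (μ.traceDensity ζ j i)) μ.traceMeasure :=
    (Complex.conjCLE : ℂ →L[ℝ] ℂ).integrable_comp h2
  refine h3.ae_eq_of_withDensityᵥ_eq h1 ?_
  ext s hs
  rw [withDensityᵥ_apply h3 hs, integral_conj, ← withDensityᵥ_apply h2 hs,
    μ.withDensityᵥ_traceDensity, μ.withDensityᵥ_traceDensity, entry_apply, entry_apply]
  exact (μ.posSemidef s).1.apply i j

theorem integral_apply {f : Circle → ℂ} (hf : Continuous f) (i j : Fin n) :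
    μ.integral f i j = ∫ ζ, f ζ * μ.traceDensity ζ i j ∂μ.traceMeasure := by
  obtain ⟨C, hC⟩ := isCompact_univ.exists_bound_of_continuousOn hf.continuousOn
  rw [integral, Matrix.of_apply, ← μ.withDensityᵥ_traceDensity]
  exact integral_withDensityᵥ_mul (μ.integrable_traceDensity i j) hf.stronglyMeasurable
    ((norm_nonneg _).trans (hC 1 trivial)) fun x => hC x trivial

end PosMatrixMeasure

/-! ### The Hermitian part of `H_α` and its boundary limit -/

variable {n : ℕ}

theorem herglotz_add_conjTranspose_apply {b : ℂ → Matrix (Fin n) (Fin n) ℂ}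
    {α : Matrix (Fin n) (Fin n) ℂ} {μ : PosMatrixMeasure n} (hμ : IsClarkMeasure b α μ)
    {z : ℂ} (hz : ‖z‖ < 1) (i j : Fin n) :
    (herglotz b α z + (herglotz b α z).conjTranspose) i j =
      2 * ∫ ζ, poisson z ζ • μ.traceDensity ζ i j ∂μ.traceMeasure := by
  have hk := continuous_herglotz_kernel hz
  obtain ⟨C, hC⟩ := isCompact_univ.exists_bound_of_continuousOn hk.continuousOn
  have hint : ∀ i j, Integrable (fun ζ : Circle =>
      (((ζ : ℂ) + z) / ((ζ : ℂ) - z)) * μ.traceDensity ζ i j) μ.traceMeasure := fun i j =>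
    (μ.integrable_traceDensity i j).bdd_mul (c := C) hk.aestronglyMeasurable
      (Eventually.of_forall fun ζ => hC ζ trivial)
  have hconj : Integrable (fun ζ : Circle => (starRingEnd ℂ)
      ((((ζ : ℂ) + z) / ((ζ : ℂ) - z)) * μ.traceDensity ζ j i)) μ.traceMeasure :=
    (Complex.conjCLE : ℂ →L[ℝ] ℂ).integrable_comp (hint j i)
  have hconst : ∀ A : Matrix (Fin n) (Fin n) ℂ,
      Complex.I • imPart A + (Complex.I • imPart A).conjTranspose = 0 := by
    intro A
    ext i j
    simp only [imPart, Matrix.add_apply, Matrix.smul_apply, Matrix.sub_apply,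
      Matrix.conjTranspose_apply, smul_eq_mul, Matrix.zero_apply, star_mul', star_sub,
      RCLike.star_def, Complex.conj_I, map_inv₀, map_mul, Complex.conj_conj, map_ofNat]
    have := Complex.I_ne_zero
    field_simp
    ring
  rw [hμ z (by simpa using hz), Matrix.conjTranspose_add, add_add_add_comm, hconst, zero_add,
    Matrix.add_apply, Matrix.conjTranspose_apply, μ.integral_apply hk, μ.integral_apply hk,
    RCLike.star_def, ← integral_conj, ← integral_add (hint i j) hconj, ← integral_const_mul]
  refine integral_congr_ae ?_
  filter_upwards [μ.ae_traceDensity_isHermitian i j] with ζ hζ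
  -- As the density is Hermitian, it factors out, leaving the kernel plus its conjugate, which is
  -- twice the Poisson kernel.
  rw [map_mul, hζ, ← add_mul, Complex.add_conj, poisson, Complex.real_smul]
  push_cast
  ring

theorem ae_tendsto_herglotz_add_conjTranspose {b : ℂ → Matrix (Fin n) (Fin n) ℂ}
    {α : Matrix (Fin n) (Fin n) ℂ} {μ : PosMatrixMeasure n} (hμ : IsClarkMeasure b α μ) :
    ∀ᵐ η ∂circleMeasure, Tendsto
      (fun z => herglotz b α z + (herglotz b α z).conjTranspose) (nontangential η)
      (𝓝 ((2 : ℂ) • μ.lebesgueDensity η)) := by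
  have h : ∀ i j, ∀ᵐ η ∂circleMeasure, _ := fun i j =>
    ae_tendsto_integral_poisson (μ.integrable_traceDensity i j)
  simp_rw [← ae_all_iff] at h
  filter_upwards [h] with η hη
  refine tendsto_pi_nhds.2 fun i => tendsto_pi_nhds.2 fun j => ?_
  have h1 := (hη i j).const_mul (2 : ℂ)
  refine Tendsto.congr' ?_ h1
  filter_upwards [eventually_nontangential_norm_lt_one η] with z hz
  exact (herglotz_add_conjTranspose_apply hμ hz i j).symm

open scoped Matrix

/-! ### Matrix identities and limits -/

theorem cayley_add_conjTranspose {B : Matrix (Fin n) (Fin n) ℂ} (hB : IsUnit (1 - B)) :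
    (1 + B) * (1 - B)⁻¹ + ((1 + B) * (1 - B)⁻¹)ᴴ =
      (2 : ℂ) • ((1 - Bᴴ)⁻¹ * (1 - Bᴴ * B) * (1 - B)⁻¹) := by
  have hdet := (Matrix.isUnit_iff_isUnit_det _).1 hB
  set X := (1 - B)⁻¹ with hX
  have h1 : (1 - B) * X = 1 := Matrix.mul_nonsing_inv _ hdet
  have hXs : Xᴴ = (1 - Bᴴ)⁻¹ := by
    rw [hX, Matrix.conjTranspose_nonsing_inv, Matrix.conjTranspose_sub,
      Matrix.conjTranspose_one]
  have h2 : Xᴴ * (1 - Bᴴ) = 1 := by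
    have := congrArg Matrix.conjTranspose h1
    simpa [Matrix.conjTranspose_mul] using this
  rw [← hXs, Matrix.conjTranspose_mul, Matrix.conjTranspose_add, Matrix.conjTranspose_one]
  -- Inserting `Xᴴ (1 - Bᴴ) = 1` on the left and `(1 - B) X = 1` on the right reduces the claim to
  -- `(1 - Bᴴ)(1 + B) + (1 + Bᴴ)(1 - B) = 2 (1 - Bᴴ B)`.
  calc (1 + B) * X + Xᴴ * (1 + Bᴴ)
      = (Xᴴ * (1 - Bᴴ)) * ((1 + B) * X) + (Xᴴ * (1 + Bᴴ)) * ((1 - B) * X) := by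
        rw [h1, h2, one_mul, mul_one]
    _ = (2 : ℂ) • (Xᴴ * (1 - Bᴴ * B) * X) := by
        rw [two_smul]
        noncomm_ring

theorem tendsto_matrix_inv {X : Type*} {l : Filter X} {A : X → Matrix (Fin n) (Fin n) ℂ}
    {A₀ : Matrix (Fin n) (Fin n) ℂ} (hA : Tendsto A l (𝓝 A₀)) (h₀ : IsUnit A₀) :
    Tendsto (fun x => (A x)⁻¹) l (𝓝 A₀⁻¹) := by
  have hdet : A₀.det ≠ 0 := ((Matrix.isUnit_iff_isUnit_det _).1 h₀).ne_zero
  simp only [Matrix.inv_def, Ring.inverse_eq_inv']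
  exact (((continuous_id.matrix_det.tendsto A₀).comp hA).inv₀ hdet).smul
    ((continuous_id.matrix_adjugate.tendsto A₀).comp hA)

theorem differentiableOn_det {A : ℂ → Matrix (Fin n) (Fin n) ℂ} {s : Set ℂ}
    (hA : ∀ i j, DifferentiableOn ℂ (fun z => A z i j) s) :
    DifferentiableOn ℂ (fun z => (A z).det) s := by
  simp only [Matrix.det_apply']
  exact DifferentiableOn.fun_sum fun σ _ =>
    (DifferentiableOn.fun_finsetProd fun i _ => hA (σ i) i).const_mul _

/-! ### Consequences of the operator norm bound on `b` -/

section Norm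

open scoped Matrix.Norms.L2Operator

theorem differentiableOn_entry {b : ℂ → Matrix (Fin n) (Fin n) ℂ} {s : Set ℂ}
    (hb : DifferentiableOn ℂ b s) (i j : Fin n) : DifferentiableOn ℂ (fun z => b z i j) s :=
  ((Matrix.entryLinearMap ℂ ℂ i j).toContinuousLinearMap).differentiable.comp_differentiableOn hb

theorem differentiableOn_one_sub_mul_entry {b : ℂ → Matrix (Fin n) (Fin n) ℂ} {s : Set ℂ}
    (hb : DifferentiableOn ℂ b s) (β : Matrix (Fin n) (Fin n) ℂ) (i j : Fin n) :
    DifferentiableOn ℂ (fun z => (1 - b z * β) i j) s := by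
  simp only [Matrix.sub_apply, Matrix.mul_apply]
  exact (differentiableOn_const _).sub
    (DifferentiableOn.fun_sum fun k _ => (differentiableOn_entry hb i k).mul_const _)

theorem exists_bound_of_norm_le_one {F : Matrix (Fin n) (Fin n) ℂ → ℂ} (hF : Continuous F) :
    ∃ M : ℝ, ∀ A : Matrix (Fin n) (Fin n) ℂ, ‖A‖ ≤ 1 → ‖F A‖ ≤ M := by
  have : ProperSpace (Matrix (Fin n) (Fin n) ℂ) := FiniteDimensional.proper ℂ _
  obtain ⟨M, hM⟩ := (isCompact_closedBall (0 : Matrix (Fin n) (Fin n) ℂ)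
    1).exists_bound_of_continuousOn hF.continuousOn
  exact ⟨M, fun A hA => hM A (by simpa using hA)⟩

theorem norm_mul_conjTranspose_of_mem_unitaryGroup {α : Matrix (Fin n) (Fin n) ℂ}
    (hα : α ∈ Matrix.unitaryGroup (Fin n) ℂ) (A : Matrix (Fin n) (Fin n) ℂ) :
    ‖A * αᴴ‖ = ‖A‖ :=
  CStarRing.norm_mul_mem_unitary A (Unitary.star_mem hα)

theorem isUnit_one_sub_of_norm_lt {B : Matrix (Fin n) (Fin n) ℂ} (hB : ‖B‖ < 1) :
    IsUnit (1 - B) :=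
  isUnit_one_sub_of_norm_lt_one hB

theorem one_sub_conjTranspose_mul_self_nonneg {B : Matrix (Fin n) (Fin n) ℂ} (hB : ‖B‖ ≤ 1) :
    0 ≤ 1 - Bᴴ * B := by
  rw [sub_nonneg]
  have h := CStarAlgebra.star_mul_le_algebraMap_norm_sq (a := B)
  refine h.trans ?_
  rw [← map_one (algebraMap ℝ (Matrix (Fin n) (Fin n) ℂ))]
  exact algebraMap_mono _ (pow_le_one₀ (norm_nonneg B) hB)

variable {b : ℂ → Matrix (Fin n) (Fin n) ℂ} {α : Matrix (Fin n) (Fin n) ℂ}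

theorem IsSchur.isUnit_one_sub (hb : IsSchur b) (hα : α ∈ Matrix.unitaryGroup (Fin n) ℂ)
    {z : ℂ} (hz : z ∈ ball (0 : ℂ) 1) : IsUnit (1 - b z * αᴴ) :=
  isUnit_one_sub_of_norm_lt (by
    rw [norm_mul_conjTranspose_of_mem_unitaryGroup hα]
    exact hb.norm_lt_one z hz)

theorem IsSchur.ae_tendsto_boundaryValue (hb : IsSchur b) : ∀ᵐ η ∂circleMeasure,
    Tendsto b (nontangential η) (𝓝 (boundaryValue b η)) := by
  have h : ∀ i j, ∀ᵐ η ∂circleMeasure,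
      ∃ l, Tendsto (fun z => b z i j) (nontangential η) (𝓝 l) := by
    intro i j
    obtain ⟨M, hM⟩ := exists_bound_of_norm_le_one (n := n) (F := fun A => A i j)
      (continuous_id.matrix_elem i j)
    exact ae_exists_tendsto_nontangential (differentiableOn_entry hb.analytic i j)
      fun z hz => hM _ (hb.norm_lt_one z hz).le
  simp_rw [← ae_all_iff] at h
  filter_upwards [h] with η hη
  choose l hl using hη
  have hlim : Tendsto b (nontangential η) (𝓝 (Matrix.of l)) :=
    tendsto_pi_nhds.2 fun i => tendsto_pi_nhds.2 fun j => hl i j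
  rwa [boundaryValue, hlim.limUnder_eq]

/-- The function `det (1 - b α*)` is holomorphic, bounded since `b` stays in a compact ball, and
zero-free since `‖b α*‖ < 1`. Its boundary values are therefore nonzero almost everywhere. -/
theorem IsSchur.ae_isUnit_one_sub_boundaryValue (hb : IsSchur b)
    (hα : α ∈ Matrix.unitaryGroup (Fin n) ℂ) : ∀ᵐ η ∂circleMeasure,
    IsUnit (1 - boundaryValue b η * αᴴ) := by
  have hcont : Continuous fun A : Matrix (Fin n) (Fin n) ℂ => (1 - A * αᴴ).det := by fun_prop
  obtain ⟨M, hM⟩ := exists_bound_of_norm_le_one hcont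
  filter_upwards [hb.ae_tendsto_boundaryValue,
    ae_limit_ne_zero (differentiableOn_det (differentiableOn_one_sub_mul_entry hb.analytic αᴴ))
      (fun z hz => hM _ (hb.norm_lt_one z hz).le)
      fun z hz => ((Matrix.isUnit_iff_isUnit_det _).1 (hb.isUnit_one_sub hα hz)).ne_zero]
    with η h1 h2
  rw [Matrix.isUnit_iff_isUnit_det, isUnit_iff_ne_zero]
  intro h0
  refine h2 ?_
  have := (hcont.tendsto _).comp h1
  rwa [h0] at this

theorem IsSchur.norm_boundaryValue_le (hb : IsSchur b) {η : Circle}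
    (h : Tendsto b (nontangential η) (𝓝 (boundaryValue b η))) : ‖boundaryValue b η‖ ≤ 1 := by
  refine le_of_tendsto ((continuous_norm.tendsto _).comp h) ?_
  filter_upwards [eventually_nontangential_norm_lt_one η] with z hz
  exact (hb.norm_lt_one z (by simpa using hz)).le

/-- The contraction bound makes the radicand `1 - (B α*)* (B α*)` nonnegative, which is needed for
the square root to square back to it. -/
theorem defect_sq {B : Matrix (Fin n) (Fin n) ℂ} (hα : α ∈ Matrix.unitaryGroup (Fin n) ℂ)
    (hB : ‖B‖ ≤ 1) : defect α B ^ 2 = 1 - α * Bᴴ * B * αᴴ := by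
  have h := one_sub_conjTranspose_mul_self_nonneg (B := B * αᴴ) (by
    rwa [norm_mul_conjTranspose_of_mem_unitaryGroup hα])
  rw [Matrix.conjTranspose_mul, Matrix.conjTranspose_conjTranspose, ← mul_assoc] at h
  exact CFC.sq_sqrt _ h

end Norm

theorem rank_defect_sq (α B : Matrix (Fin n) (Fin n) ℂ) :
    (defect α B ^ 2).rank = (defect α B).rank := by
  have h : (defect α B).IsHermitian :=
    (Matrix.nonneg_iff_posSemidef.1 (CFC.sqrt_nonneg _)).1
  rw [← Matrix.rank_conjTranspose_mul_self (defect α B), h.eq, sq]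

theorem tendsto_one_sub_mul_conjTranspose_mul {X : Type*} {l : Filter X}
    {A : X → Matrix (Fin n) (Fin n) ℂ} {A₀ : Matrix (Fin n) (Fin n) ℂ}
    (α : Matrix (Fin n) (Fin n) ℂ) (hA : Tendsto A l (𝓝 A₀)) :
    Tendsto (fun x => 1 - α * (A x)ᴴ * A x * αᴴ) l (𝓝 (1 - α * A₀ᴴ * A₀ * αᴴ)) := by
  have hs : Tendsto (fun x => (A x)ᴴ) l (𝓝 A₀ᴴ) :=
    (continuous_id.matrix_conjTranspose.tendsto A₀).comp hA
  exact (((hs.const_mul α).mul hA).mul_const αᴴ).const_sub 1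

theorem herglotz_add_conjTranspose {b : ℂ → Matrix (Fin n) (Fin n) ℂ}
    {α : Matrix (Fin n) (Fin n) ℂ} {z : ℂ} (h : IsUnit (1 - b z * αᴴ)) :
    herglotz b α z + (herglotz b α z)ᴴ =
      (2 : ℂ) • ((1 - α * (b z)ᴴ)⁻¹ * (1 - α * (b z)ᴴ * b z * αᴴ) * (1 - b z * αᴴ)⁻¹) := by
  have h1 := cayley_add_conjTranspose h
  rw [Matrix.conjTranspose_mul (b z), Matrix.conjTranspose_conjTranspose, ← mul_assoc (α * _)] at h1
  exact h1

end AleksandrovClark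

theorem theorem2p1 (n : ℕ) (b : ℂ → Matrix (Fin n) (Fin n) ℂ)
    (hb : AleksandrovClark.IsSchur b) (α : Matrix (Fin n) (Fin n) ℂ)
    (hα : α ∈ Matrix.unitaryGroup (Fin n) ℂ) (μ : AleksandrovClark.PosMatrixMeasure n)
    (hμ : AleksandrovClark.IsClarkMeasure b α μ) :
    ∀ᵐ ζ ∂AleksandrovClark.circleMeasure,
      Filter.Tendsto b (AleksandrovClark.nontangential ζ)
        (nhds (AleksandrovClark.boundaryValue b ζ)) ∧
      IsUnit (1 - AleksandrovClark.boundaryValue b ζ * α.conjTranspose) ∧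
      μ.lebesgueDensity ζ =
        (1 - α * (AleksandrovClark.boundaryValue b ζ).conjTranspose)⁻¹ *
          AleksandrovClark.defect α (AleksandrovClark.boundaryValue b ζ) ^ 2 *
          (1 - AleksandrovClark.boundaryValue b ζ * α.conjTranspose)⁻¹ ∧
      (μ.lebesgueDensity ζ).rank =
        (AleksandrovClark.defect α (AleksandrovClark.boundaryValue b ζ)).rank := by
  open AleksandrovClark in
  filter_upwards [hb.ae_tendsto_boundaryValue, hb.ae_isUnit_one_sub_boundaryValue hα,
    ae_tendsto_herglotz_add_conjTranspose hμ] with ζ hlim hunit hre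
  set B := boundaryValue b ζ with hB
  have hadj : (1 - B * α.conjTranspose).conjTranspose = 1 - α * B.conjTranspose := by
    simp [Matrix.conjTranspose_mul]
  have hunit' : IsUnit (1 - α * B.conjTranspose) := by
    rw [← hadj]
    exact hunit.star
  have hright : Tendsto (fun z => (1 - b z * α.conjTranspose)⁻¹) (nontangential ζ)
      (𝓝 (1 - B * α.conjTranspose)⁻¹) :=
    tendsto_matrix_inv (((by fun_prop : Continuous fun A : Matrix (Fin n) (Fin n) ℂ =>
      1 - A * α.conjTranspose).tendsto B).comp hlim) hunit
  have hleft : Tendsto (fun z => (1 - α * (b z).conjTranspose)⁻¹) (nontangential ζ)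
      (𝓝 (1 - α * B.conjTranspose)⁻¹) :=
    tendsto_matrix_inv (((by fun_prop : Continuous fun A : Matrix (Fin n) (Fin n) ℂ =>
      1 - α * A.conjTranspose).tendsto B).comp hlim) hunit'
  have hmid : Tendsto (fun z => 1 - α * (b z).conjTranspose * b z * α.conjTranspose)
      (nontangential ζ) (𝓝 (1 - α * B.conjTranspose * B * α.conjTranspose)) :=
    tendsto_one_sub_mul_conjTranspose_mul α hlim
  have hlim' := (hleft.mul hmid).mul hright
  have hre' := hlim'.const_smul (2 : ℂ)
  have heq : ∀ᶠ z in nontangential ζ, herglotz b α z + (herglotz b α z).conjTranspose =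
      (2 : ℂ) • ((1 - α * (b z).conjTranspose)⁻¹ *
        (1 - α * (b z).conjTranspose * b z * α.conjTranspose) *
        (1 - b z * α.conjTranspose)⁻¹) := by
    filter_upwards [eventually_nontangential_norm_lt_one ζ] with z hz
    exact herglotz_add_conjTranspose (hb.isUnit_one_sub hα (by simpa using hz))
  -- Both limits of `H_α + H_α*` coincide; the common factor `2` is cancelled.
  have hdens := smul_right_injective _ (two_ne_zero (α := ℂ))
    (tendsto_nhds_unique (hre.congr' heq) hre')
  rw [← defect_sq hα (hb.norm_boundaryValue_le hlim)] at hdens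
  refine ⟨hlim, hunit, hdens, ?_⟩
  rw [hdens, Matrix.rank_mul_eq_left_of_isUnit_det _ _ ((Matrix.isUnit_iff_isUnit_det _).1
      ((Matrix.isUnit_nonsing_inv_iff).2 hunit)),
    Matrix.rank_mul_eq_right_of_isUnit_det _ _ ((Matrix.isUnit_iff_isUnit_det _).1
      ((Matrix.isUnit_nonsing_inv_iff).2 hunit')), rank_defect_sq]
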